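/- **Notation.** For $\ell\in\tfrac12\mathbb N$ (with $0\in\mathbb N$) let $SU(2)$ act on the space of complex polynomials $\varphi$ in $x$ of degree at most $2\ell$ by $(T_\ell(g)\varphi)(x)=(\beta x+\delta)^{2\ell}\,\varphi\!\left(\frac{\alpha x+\gamma}{\beta x+\delta}\right)$ for $g=\begin{pmatrix}\alpha&\beta\\ \gamma&\delta\end{pmatrix}$; this is the irreducible representation of spin $\ell$. Its matrix elements $t^\ell_{m,n}$, for $m,n\in\{-\ell,-\ell+1,\dots,\ell\}$, are defined by $T_\ell(g)\psi_n=\sum_m t^\ell_{m,n}(g)\,\psi_m$, where $\psi_n=x^{\ell-n}/\sqrt{(\ell-n)!\,(\ell+n)!}$. Let $dg$ be the normalised Haar measure on $SU(2)$. A function $SU(2)\to\mathbb C$ is called $SU(2)$-finite if it is continuous and its translates span a finite-dimensional space; equivalently, if it is a finite linear combination of matrix elements $t^\ell_{m,n}$. For a function $$f=\sum_{i=1}^k A_i\,t^{\ell_i}_{m_i,n_i},\qquad A_i\in\mathbb C\setminus\{0\},\quad (\ell_i,m_i,n_i)\ \text{pairwise distinct},\tag{1}$$ consider the statement > $C(f)$: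 one has $\int_{SU(2)}f(g)^P\,dg=0$ for all integers $P>0$ if and only if $(0,0)$ is not contained in the closed convex hull of $\{(m_i,n_i):1\le i\le k\}$ in $\mathbb R^2$. For an $SU(2)$-finite function $f$ consider the statement > $M(f)$: if $\int_{SU(2)}f(g)^P\,dg=0$ for all integers $P>0$, then for every $SU(2)$-finite function $h$ one has $\int_{SU(2)}f(g)^P\,h(g)\,dg=0$ for all sufficiently large $P$. **Theorem.** 1. For every $f$ as in (1), $C(f)$ implies $M(f)$. 2. In particular, if $C(f)$ holds for every $f$ as in (1), then the Mathieu Conjecture holds for $SU(2)$, that is, $M(f)$ holds for every $SU(2)$-finite function $f$. -/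

import Mathlib

open MeasureTheory Filter
open scoped Nat Polynomial

noncomputable section

/-- The integral of a complex-valued function on a compact group against the normalised
(total mass one) Haar measure. -/
def haarIntegral (G : Type*) [Group G] [TopologicalSpace G] [IsTopologicalGroup G]
    [CompactSpace G] [MeasurableSpace G] [BorelSpace G] (f : G → ℂ) : ℂ :=
  ∫ g, f g ∂(Measure.haarMeasure (⊤ : TopologicalSpace.PositiveCompacts G))

/-- `G`-finite functions: continuous functions whose left translates span a finite-dimensional
space. (For continuous functions on a compact group, using right translates, or translates on both
sides, gives the same class.) -/
def IsGFinite {G : Type*} [Group G] [TopologicalSpace G] (f : G → ℂ) : Prop :=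
  Continuous f ∧
    FiniteDimensional ℂ (Submodule.span ℂ (Set.range fun a : G => fun x : G => f (a * x)))

/-- The implication of Mathieu's conjecture for one function `f`: if all positive powers of `f`
integrate to zero then, for each `G`-finite `h`, the integral of `f ^ P * h` vanishes for all
sufficiently large `P`. -/
def MathieuProperty {G : Type*} [Group G] [TopologicalSpace G] [IsTopologicalGroup G]
    [CompactSpace G] [MeasurableSpace G] [BorelSpace G] (f : G → ℂ) : Prop :=
  (∀ P : ℕ, 0 < P → haarIntegral G (fun g => f g ^ P) = 0) →
    ∀ h : G → ℂ, IsGFinite h → ∀ᶠ P : ℕ in atTop, haarIntegral G (fun g => f g ^ P * h g) = 0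

/-- Mathieu's conjecture for the compact group `G`. -/
def MathieuConjectureFor (G : Type*) [Group G] [TopologicalSpace G] [IsTopologicalGroup G]
    [CompactSpace G] [MeasurableSpace G] [BorelSpace G] : Prop :=
  ∀ f : G → ℂ, IsGFinite f → MathieuProperty f

/-- The group `SU(2)`. -/
abbrev SU2 : Type := Matrix.specialUnitaryGroup (Fin 2) ℂ

instance : IsTopologicalGroup SU2 where
  continuous_mul := by fun_prop
  continuous_inv :=
    Continuous.subtype_mk (continuous_star.comp continuous_subtype_val) fun g => (star g).2

instance : CompactSpace SU2 := by
  refine isCompact_iff_compactSpace.1 ?_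
  have hK : IsCompact (Set.univ.pi fun _ : Fin 2 => Set.univ.pi fun _ : Fin 2 =>
      Metric.closedBall (0 : ℂ) 1) :=
    isCompact_univ_pi fun _ => isCompact_univ_pi fun _ => isCompact_closedBall _ _
  have hcl : IsClosed (Matrix.specialUnitaryGroup (Fin 2) ℂ : Set (Matrix (Fin 2) (Fin 2) ℂ)) := by
    have h : (Matrix.specialUnitaryGroup (Fin 2) ℂ : Set (Matrix (Fin 2) (Fin 2) ℂ)) =
        {A | A * star A = 1} ∩ {A | A.det = 1} := by
      ext A
      simp [Matrix.mem_specialUnitaryGroup_iff, Matrix.mem_unitaryGroup_iff]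
    rw [h]
    exact (isClosed_eq (by fun_prop) continuous_const).inter
      (isClosed_eq (Continuous.matrix_det continuous_id) continuous_const)
  refine IsCompact.of_isClosed_subset hK hcl ?_
  intro A hA i _ j _
  have := entry_norm_bound_of_unitary (Matrix.mem_specialUnitaryGroup_iff.1 hA).1 i j
  simpa using this

instance : MeasurableSpace SU2 := borel SU2

instance : BorelSpace SU2 := ⟨rfl⟩

/-- Labels `(ℓ, m, n)` of the matrix elements `t^ℓ_{m,n}`, with `ℓ ∈ ½ℕ` and
`m, n ∈ {-ℓ, -ℓ + 1, …, ℓ}`. The spin is encoded by the natural number `N = 2ℓ`, and `m`, `n` by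
their positions `i = m + ℓ`, `j = n + ℓ` in `{0, …, N}`. -/
abbrev SpinLabel : Type := Σ N : ℕ, Fin (N + 1) × Fin (N + 1)

/-- The weight `(m, n) = (i - ℓ, j - ℓ)` of a label. -/
def SpinLabel.weight (s : SpinLabel) : ℝ × ℝ :=
  ((s.2.1 : ℝ) - (s.1 : ℝ) / 2, (s.2.2 : ℝ) - (s.1 : ℝ) / 2)

/-- The matrix element `t^ℓ_{m,n}` of the spin `ℓ` irreducible unitary representation of `SU(2)`.

The representation space consists of the polynomials `φ` in `X` of degree at most `2ℓ`, on which
`g = !![α, β; γ, δ]` acts by `(T g φ)(X) = (β X + δ) ^ (2ℓ) * φ ((α X + γ) / (β X + δ))`. The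
standard (orthonormal) basis is `ψ_n = X ^ (ℓ - n) / √((ℓ - n)! (ℓ + n)!)` for `n = -ℓ, …, ℓ`, and
the matrix elements are defined by `T g ψ_n = ∑ m, t^ℓ_{m,n}(g) ψ_m`. Here
`T g ψ_n = (α X + γ) ^ (ℓ - n) (β X + δ) ^ (ℓ + n) / √((ℓ - n)! (ℓ + n)!)`, and with
`i = ℓ + m`, `j = ℓ + n` one has `ℓ - m = N - i` and `ℓ - n = N - j`. -/
def matrixElement (s : SpinLabel) (g : SU2) : ℂ :=
  let N := s.1
  let i : ℕ := s.2.1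
  let j : ℕ := s.2.2
  (Real.sqrt ((((N - i)! * i ! : ℕ) : ℝ) / (((N - j)! * j ! : ℕ) : ℝ)) : ℂ) *
    ((Polynomial.C (g.1 0 0) * Polynomial.X + Polynomial.C (g.1 1 0)) ^ (N - j) *
      (Polynomial.C (g.1 0 1) * Polynomial.X + Polynomial.C (g.1 1 1)) ^ j : ℂ[X]).coeff (N - i)

/-- The linear combination `∑ i, A i • t^{ℓ i}_{m i, n i}` of matrix elements. -/
def matrixElementSum {k : ℕ} (A : Fin k → ℂ) (s : Fin k → SpinLabel) (g : SU2) : ℂ :=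
  ∑ i, A i * matrixElement (s i) g

/-- For `f = ∑ i, A i • t^{ℓ i}_{m i, n i}`: all positive powers of `f` integrate to zero over
`SU(2)` if and only if `(0, 0)` is not in the closed convex hull of the weights `(m i, n i)`. -/
def ConvexHullCriterion {k : ℕ} (A : Fin k → ℂ) (s : Fin k → SpinLabel) : Prop :=
  (∀ P : ℕ, 0 < P → haarIntegral SU2 (fun g => matrixElementSum A s g ^ P) = 0) ↔
    ((0, 0) : ℝ × ℝ) ∉ closedConvexHull ℝ (Set.range fun i => (s i).weight)

/-- The convex hull criterion holds for every linear combination of pairwise distinct matrix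
elements with nonzero coefficients. -/
def ConvexHullConjecture : Prop :=
  ∀ (k : ℕ) (A : Fin k → ℂ) (s : Fin k → SpinLabel),
    (∀ i, A i ≠ 0) → Function.Injective s → ConvexHullCriterion A s

end

/-! If all positive powers of `f` integrate to zero, the criterion keeps the origin out of the
closed convex hull of the weights, so some linear functional is at least `c > 0` on every weight.
Expanding `f ^ P` gives products of `P` matrix elements, each an eigenfunction of left and right
translation by a torus element, with eigenvalues that encode the sum of its weights; the functional
is at least `P * c` on that sum. A finite function `h` pairs nontrivially with only finitely many
such eigenvalues, hence only with bounded weight sums, so every term vanishes for large `P`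
(`mathieuProperty_of_zero_notMem`).

For the second claim, a finite function must be shown to be a combination of matrix elements
(`IsGFinite.mem_matrixElementSpan`). Their span is the algebra of polynomials in the entries: dense
by Stone–Weierstrass and stable under convolution. A duality argument, `IsGFinite.mem_of_dense`,
shows that such a space contains every finite function. -/

/-! ### Finite-dimensional spaces of functions and eigenvalues -/

/-- A finite-dimensional space of functions is determined by finitely many evaluations. -/
theorem exists_finset_eval_eq_sum {X : Type*} (V : Submodule ℂ (X → ℂ)) [FiniteDimensional ℂ V] :
    ∃ (s : Finset X) (d : X → X → ℂ), ∀ v ∈ V, ∀ x, v x = ∑ y ∈ s, d y x * v y := by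
  classical
  let ev : X → Module.Dual ℂ V := fun x => (LinearMap.proj x).comp V.subtype
  have hfg : (Submodule.span ℂ (Set.range ev)).FG := Submodule.FG.of_finite
  -- Evaluations lie in the finite-dimensional dual of `V`, so finitely many of them span all the
  -- others.
  obtain ⟨t, ht, hspan⟩ := (Submodule.fg_span_iff_fg_span_finset_subset _).1 hfg
  rw [← Set.image_univ, Finset.subset_set_image_iff] at ht
  obtain ⟨s, -, rfl⟩ := ht
  have hmem : ∀ x, ∃ c : X → ℂ, ∑ y ∈ s, c y • ev y = ev x := by
    intro x
    have : ev x ∈ Submodule.span ℂ (Set.range ev) := Submodule.subset_span ⟨x, rfl⟩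
    rw [hspan, Finset.coe_image] at this
    obtain ⟨c, hc⟩ := (Submodule.mem_span_image_finset_iff_exists_fun ℂ).1 this
    refine ⟨fun y => if h : y ∈ s then c ⟨y, h⟩ else 0, ?_⟩
    rw [← hc, ← Finset.sum_coe_sort]
    exact Finset.sum_congr rfl fun y _ => by simp
  choose c hc using hmem
  refine ⟨s, fun y x => c x y, fun v hv x => ?_⟩
  have := congrArg (fun L : Module.Dual ℂ V => L ⟨v, hv⟩) (hc x)
  simpa [ev] using this.symm

/-- If the iterates `h ∘ T^[n]` of a measure-preserving `T` stay in a finite-dimensional space,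
then `h` is orthogonal to the eigenfunctions of `T` for all but finitely many eigenvalues. -/
theorem exists_finite_eigenvalues_of_integral_ne_zero {X : Type*} [TopologicalSpace X]
    [CompactSpace X] [MeasurableSpace X] [BorelSpace X] (μ : Measure X)
    [IsFiniteMeasureOnCompacts μ] {T : X → X} (hT : Continuous T)
    (hμ : ∀ F : X → ℂ, ∫ x, F (T x) ∂μ = ∫ x, F x ∂μ)
    {h : X → ℂ} (hh : Continuous h) (V : Submodule ℂ (X → ℂ)) [FiniteDimensional ℂ V]
    (hV : ∀ n, (fun x => h (T^[n] x)) ∈ V) :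
    ∃ E : Set ℂ, E.Finite ∧ ∀ (q : X → ℂ) (z : ℂ), Continuous q → z ≠ 0 →
      (∀ x, q (T x) = z * q x) → ∫ x, q x * h x ∂μ ≠ 0 → z ∈ E := by
  have hdep := Module.Finite.not_linearIndependent_of_infinite (R := ℂ)
    (fun n : ℕ => (⟨_, hV n⟩ : V))
  obtain ⟨s, g, hsum, i₀, hi₀, hg⟩ := not_linearIndependent_iff.1 hdep
  have hrel : ∀ x, ∑ i ∈ s, g i * h (T^[i] x) = 0 := by
    intro x
    have := congrArg (fun v : V => (v : X → ℂ) x) hsum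
    simpa [Finset.sum_apply] using this
  -- Pairing the dependence relation with `q` gives `p(z⁻¹) * ∫ q h = 0`, because each application
  -- of `T` to `h` contributes a factor `z⁻¹`. The exceptional eigenvalues are thus inverses of
  -- roots of `p`.
  let p : ℂ[X] := ∑ i ∈ s, Polynomial.monomial i (g i)
  have hp : p ≠ 0 := by
    intro hp
    have := congrArg (fun p : ℂ[X] => p.coeff i₀) hp
    simp [p, Polynomial.finsetSum_coeff, Polynomial.coeff_monomial, hi₀, hg] at this
  refine ⟨(fun z : ℂ => z⁻¹) '' (p.roots.toFinset : Set ℂ), (Finset.finite_toSet _).image _,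
    fun q z hq hz hqz hne => ⟨z⁻¹, ?_, inv_inv z⟩⟩
  have hiter : ∀ (n : ℕ) (F : X → ℂ), ∫ x, F (T^[n] x) ∂μ = ∫ x, F x ∂μ := by
    intro n
    induction n with
    | zero => intro F; rfl
    | succ n ih =>
      intro F
      have := hμ fun x => F (T^[n] x)
      simpa [Function.iterate_succ_apply, ih] using this
  have hqiter : ∀ (n : ℕ) x, q (T^[n] x) = z ^ n * q x := by
    intro n
    induction n with
    | zero => simp
    | succ n ih => intro x; rw [Function.iterate_succ_apply, ih, hqz]; ring
  have hint : ∀ n : ℕ, ∫ x, q x * h (T^[n] x) ∂μ = z⁻¹ ^ n * ∫ x, q x * h x ∂μ := by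
    intro n
    rw [← hiter n fun x => q x * h x]
    simp_rw [hqiter, mul_assoc]
    rw [integral_const_mul, ← mul_assoc, ← mul_pow, inv_mul_cancel₀ hz, one_pow, one_mul]
  have key : p.eval z⁻¹ * ∫ x, q x * h x ∂μ = 0 := by
    have h0 : ∫ x, ∑ i ∈ s, g i * (q x * h (T^[i] x)) ∂μ = 0 := by
      rw [← integral_zero X ℂ (μ := μ)]
      congr 1
      ext x
      rw [← mul_zero (q x), ← hrel x, Finset.mul_sum]
      exact Finset.sum_congr rfl fun i _ => by ring
    rw [integral_finsetSum _ fun i _ => ?_] at h0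
    · simp_rw [integral_const_mul, hint] at h0
      rw [← h0, Polynomial.eval_finsetSum, Finset.sum_mul]
      exact Finset.sum_congr rfl fun i _ => by simp [mul_assoc]
    · exact Continuous.integrable_of_hasCompactSupport
        (continuous_const.mul (hq.mul (hh.comp (hT.iterate i)))) (HasCompactSupport.of_compactSpace _)
  have hroot := (mul_eq_zero.1 key).resolve_right hne
  simpa [hp] using hroot

/-- The values of the left translates of a `G`-finite function are determined by finitely many
of its right translates. -/
theorem IsGFinite.exists_finset_mul_eq_sum {G : Type*} [Group G] [TopologicalSpace G]
    {f : G → ℂ} (hf : IsGFinite f) :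
    ∃ (s : Finset G) (d : G → G → ℂ), ∀ a x, f (a * x) = ∑ y ∈ s, d y x * f (a * y) := by
  have := hf.2
  obtain ⟨s, d, h⟩ := exists_finset_eval_eq_sum
    (Submodule.span ℂ (Set.range fun a : G => fun x : G => f (a * x)))
  exact ⟨s, d, fun a x => h _ (Submodule.subset_span ⟨a, rfl⟩) x⟩

/-! ### Finite functions on compact groups -/

section CompactGroup

variable {G : Type*} [Group G] [TopologicalSpace G] [IsTopologicalGroup G]
    [CompactSpace G] [MeasurableSpace G] [BorelSpace G]

theorem Continuous.integrable_haarMeasure_top {f : G → ℂ} (hf : Continuous f) :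
    Integrable f (Measure.haarMeasure (⊤ : TopologicalSpace.PositiveCompacts G)) :=
  hf.integrable_of_hasCompactSupport (HasCompactSupport.of_compactSpace _)

theorem haarIntegral_mul_left (f : G → ℂ) (a : G) :
    haarIntegral G (fun x => f (a * x)) = haarIntegral G f :=
  integral_mul_left_eq_self f a

/-- Compact groups are unimodular. -/
theorem haarIntegral_mul_right (f : G → ℂ) (a : G) :
    haarIntegral G (fun x => f (x * a)) = haarIntegral G f := by
  let μ : Measure G := Measure.haarMeasure (⊤ : TopologicalSpace.PositiveCompacts G)
  -- The push-forward is again left invariant, hence a multiple of `μ`; comparing total masses makes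
  -- the factor one.
  have hmap : μ.map (· * a) = μ := by
    have hsm := Measure.isMulInvariant_eq_smul_of_compactSpace (μ.map (· * a)) μ
    have huniv := congrArg (fun ν : Measure G => ν Set.univ) hsm
    have hmass : μ Set.univ = 1 := Measure.haarMeasure_self
    simp only [Measure.smul_apply] at huniv
    rw [Measure.map_apply (measurable_mul_const a) MeasurableSet.univ, Set.preimage_univ,
      hmass] at huniv
    have hc : (μ.map (· * a)).haarScalarFactor μ = 1 := by
      rw [ENNReal.smul_def, smul_eq_mul, mul_one] at huniv
      exact_mod_cast huniv.symm
    rw [hsm, hc, one_smul]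
  change ∫ x, f (x * a) ∂μ = ∫ x, f x ∂μ
  conv_rhs => rw [← hmap]
  exact ((MeasurableEquiv.mulRight a).measurableEmbedding.integral_map f).symm

theorem IsGFinite.exists_finite_eigenvalues_mul_left {h : G → ℂ} (hh : IsGFinite h) (t : G) :
    ∃ E : Set ℂ, E.Finite ∧ ∀ (q : G → ℂ) (z : ℂ), Continuous q → z ≠ 0 →
      (∀ x, q (t * x) = z * q x) → haarIntegral G (fun x => q x * h x) ≠ 0 → z ∈ E := by
  have := hh.2
  refine exists_finite_eigenvalues_of_integral_ne_zero _ (continuous_const_mul t)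
    (fun F => haarIntegral_mul_left F t) hh.1
    (Submodule.span ℂ (Set.range fun a : G => fun x : G => h (a * x))) fun n => ?_
  simp_rw [mul_left_iterate]
  exact Submodule.subset_span ⟨t ^ n, rfl⟩

theorem IsGFinite.exists_finite_eigenvalues_mul_right {h : G → ℂ} (hh : IsGFinite h) (t : G) :
    ∃ E : Set ℂ, E.Finite ∧ ∀ (q : G → ℂ) (z : ℂ), Continuous q → z ≠ 0 →
      (∀ x, q (x * t) = z * q x) → haarIntegral G (fun x => q x * h x) ≠ 0 → z ∈ E := by
  classical
  obtain ⟨s, d, hd⟩ := hh.exists_finset_mul_eq_sum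
  have : FiniteDimensional ℂ (Submodule.span ℂ
      ((s.image fun y => fun x : G => h (x * y) : Finset (G → ℂ)) : Set (G → ℂ))) :=
    FiniteDimensional.span_finset ℂ _
  refine exists_finite_eigenvalues_of_integral_ne_zero _ (continuous_mul_const t)
    (fun F => haarIntegral_mul_right F t) hh.1
    (Submodule.span ℂ ((s.image fun y => fun x : G => h (x * y) : Finset (G → ℂ)) :
      Set (G → ℂ))) fun n => ?_
  -- Finiteness is stated for left translates; the evaluation formula puts all right translates in
  -- one finite-dimensional space.
  have : (fun x => h ((· * t)^[n] x)) = ∑ y ∈ s, d y (t ^ n) • fun x : G => h (x * y) := by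
    ext x
    simp [mul_right_iterate, hd x (t ^ n)]
  rw [this]
  exact Submodule.sum_mem _ fun y hy => Submodule.smul_mem _ _
    (Submodule.subset_span (Finset.mem_coe.2 (Finset.mem_image_of_mem _ hy)))

/-- A `G`-finite function lies in every dense space of continuous functions that is stable under
convolution with continuous functions. -/
theorem IsGFinite.mem_of_dense {f : G → ℂ} (hf : IsGFinite f) (S : Submodule ℂ (G → ℂ))
    (hdense : Dense {k : C(G, ℂ) | (k : G → ℂ) ∈ S})
    (hconv : ∀ k ∈ S, ∀ w : G → ℂ, Continuous k → Continuous w →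
      (fun x => haarIntegral G fun y => k (x * y) * w y) ∈ S) : f ∈ S := by
  by_contra hfS
  obtain ⟨Λ, hΛf, hΛ⟩ := Submodule.exists_le_ker_of_notMem hfS
  obtain ⟨s, d, hd⟩ := hf.exists_finset_mul_eq_sum
  -- `F y` is `Λ` applied to `x ↦ f (y⁻¹ * x)`; the finite sum makes its continuity visible. In
  -- particular `F 1 = Λ f`.
  let F : G → ℂ := fun y => ∑ j ∈ s, Λ (d j) * f (y⁻¹ * j)
  have hfc := hf.1
  have hF : Continuous F := by fun_prop
  -- Substituting `y ↦ x⁻¹ * y` turns the convolution of `k` with `y ↦ f y⁻¹` into a combination of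
  -- the `d j`. It lies in `S`, so `Λ` kills it, and its value under `Λ` is the integral of `k * F`.
  have hkF : ∀ k : C(G, ℂ), (k : G → ℂ) ∈ S → haarIntegral G (fun y => k y * F y) = 0 := by
    intro k hk
    have hmem := hΛ (hconv k hk (fun y => f y⁻¹) k.continuous (by fun_prop))
    have heq : (fun x => haarIntegral G fun y => k (x * y) * f y⁻¹) =
        ∑ j ∈ s, haarIntegral G (fun y => k y * f (y⁻¹ * j)) • d j := by
      ext x
      have h1 : haarIntegral G (fun y => k (x * y) * f y⁻¹) =
          haarIntegral G (fun y => k y * f (y⁻¹ * x)) := by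
        rw [← haarIntegral_mul_left (fun y => k y * f (y⁻¹ * x)) x]
        simp [mul_assoc]
      rw [h1, Finset.sum_apply]
      simp_rw [hd _ x, Finset.mul_sum]
      unfold haarIntegral
      rw [integral_finsetSum _ fun j _ => Continuous.integrable_haarMeasure_top (by fun_prop)]
      refine Finset.sum_congr rfl fun j _ => ?_
      rw [Pi.smul_apply, smul_eq_mul, ← integral_mul_const]
      congr 1
      ext y
      ring
    rw [heq, LinearMap.mem_ker, map_sum] at hmem
    rw [← hmem]
    simp only [F, Finset.mul_sum]
    unfold haarIntegral
    rw [integral_finsetSum _ fun j _ => Continuous.integrable_haarMeasure_top (by fun_prop)]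
    refine Finset.sum_congr rfl fun j _ => ?_
    rw [map_smul, smul_eq_mul, ← integral_mul_const]
    congr 1
    ext y
    ring
  have hall : ∀ k : C(G, ℂ), haarIntegral G (fun y => k y * F y) = 0 := by
    let F' : C(G, ℂ) := ⟨F, hF⟩
    let μ : Measure G := Measure.haarMeasure (⊤ : TopologicalSpace.PositiveCompacts G)
    have hcont : Continuous fun k : C(G, ℂ) => haarIntegral G (fun y => k y * F y) := by
      have : Continuous fun k : C(G, ℂ) => ∫ y, ContinuousMap.toLp (E := ℂ) 1 μ ℂ (k * F') y ∂μ :=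
        continuous_integral.comp ((ContinuousMap.toLp (E := ℂ) 1 μ ℂ).continuous.comp
          (continuous_mul_const F'))
      refine this.congr fun k => ?_
      exact integral_congr_ae (ContinuousMap.coeFn_toLp (p := 1) (𝕜 := ℂ) μ (k * F'))
    exact fun k => congrFun (Continuous.ext_on hdense hcont continuous_const hkF) k
  have hF1 : F 1 = 0 := by
    by_contra hne
    have hpos : 0 < ∫ y, ‖F y‖ ^ 2 ∂(Measure.haarMeasure
        (⊤ : TopologicalSpace.PositiveCompacts G)) :=
      Continuous.integral_pos_of_hasCompactSupport_nonneg_nonzero (x := 1) (by fun_prop)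
        (HasCompactSupport.of_compactSpace _) (fun y => by positivity) (by positivity)
    -- Testing against the conjugate of `F` gives its squared norm.
    have h0 := hall ⟨fun y => star (F y), by fun_prop⟩
    have h1 : haarIntegral G (fun y => star (F y) * F y) = ((∫ y, ‖F y‖ ^ 2 ∂(Measure.haarMeasure
        (⊤ : TopologicalSpace.PositiveCompacts G)) : ℝ) : ℂ) := by
      unfold haarIntegral
      rw [← integral_complex_ofReal]
      congr 1
      ext y
      simpa using Complex.conj_mul' (F y)
    have h2 : haarIntegral G (fun y => star (F y) * F y) = 0 := h0
    rw [h1] at h2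
    exact hpos.ne' (by exact_mod_cast h2)
  apply hΛf
  have : f = ∑ j ∈ s, f j • d j := by
    ext x
    have := hd 1 x
    simp only [one_mul] at this
    rw [this]
    simp [mul_comm]
  rw [this, map_sum, ← hF1]
  simp [F, mul_comm]

end CompactGroup

/-! ### Matrix elements and their torus weights -/

theorem coeff_C_mul_X_add_C_pow {R : Type*} [CommSemiring R] (a b : R) (n k : ℕ) :
    ((Polynomial.C a * Polynomial.X + Polynomial.C b) ^ n).coeff k =
      n.choose k * (a ^ k * b ^ (n - k)) := by
  have h : (Polynomial.C a * Polynomial.X + Polynomial.C b) ^ n =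
      ∑ m ∈ Finset.range (n + 1), Polynomial.monomial m (n.choose m * (a ^ m * b ^ (n - m))) := by
    rw [add_pow]
    refine Finset.sum_congr rfl fun m _ => ?_
    rw [mul_pow, ← Polynomial.C_pow, ← Polynomial.C_pow, ← Polynomial.C_mul_X_pow_eq_monomial]
    simp only [map_mul, map_natCast]
    ring
  rw [h, Polynomial.finsetSum_coeff]
  simp_rw [Polynomial.coeff_monomial]
  rw [Finset.sum_ite_eq']
  split_ifs with hk
  · rfl
  · rw [Nat.choose_eq_zero_of_lt (by simpa using hk)]
    simp

/-- The monomial `α ^ a * β ^ b * γ ^ c * δ ^ d` in the entries of `!![α, β; γ, δ]`. -/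
def entryMonomial (a b c d : ℕ) (g : SU2) : ℂ :=
  g.1 0 0 ^ a * g.1 0 1 ^ b * g.1 1 0 ^ c * g.1 1 1 ^ d

theorem SU2.continuous_entry (i j : Fin 2) : Continuous fun g : SU2 => g.1 i j :=
  (continuous_apply_apply i j).comp continuous_subtype_val

theorem continuous_entryMonomial (a b c d : ℕ) : Continuous (entryMonomial a b c d) :=
  ((((SU2.continuous_entry 0 0).pow a).mul ((SU2.continuous_entry 0 1).pow b)).mul
    ((SU2.continuous_entry 1 0).pow c)).mul ((SU2.continuous_entry 1 1).pow d)

theorem exists_matrixElement_eq (s : SpinLabel) : ∃ r : ℂ, r ≠ 0 ∧ ∀ g, matrixElement s g =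
    r * ∑ p ∈ Finset.HasAntidiagonal.antidiagonal (s.1 - (s.2.1 : ℕ)),
      ((s.1 - (s.2.2 : ℕ)).choose p.1 * (s.2.2 : ℕ).choose p.2 : ℂ) *
        entryMonomial p.1 p.2 (s.1 - (s.2.2 : ℕ) - p.1) ((s.2.2 : ℕ) - p.2) g := by
  refine ⟨(Real.sqrt ((((s.1 - (s.2.1 : ℕ))! * (s.2.1 : ℕ)! : ℕ) : ℝ) /
    (((s.1 - (s.2.2 : ℕ))! * (s.2.2 : ℕ)! : ℕ) : ℝ)) : ℂ), ?_, fun g => ?_⟩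
  swap
  · rw [matrixElement, Polynomial.coeff_mul]
    congr 1
    refine Finset.sum_congr rfl fun p _ => ?_
    rw [coeff_C_mul_X_add_C_pow, coeff_C_mul_X_add_C_pow, entryMonomial]
    ring
  · rw [Complex.ofReal_ne_zero]
    exact (Real.sqrt_pos.2 (by positivity)).ne'

theorem continuous_matrixElement (s : SpinLabel) : Continuous (matrixElement s) := by
  obtain ⟨r, -, h⟩ := exists_matrixElement_eq s
  rw [funext h]
  exact continuous_const.mul (continuous_finsetSum _ fun p _ =>
    continuous_const.mul (continuous_entryMonomial _ _ _ _))

/-- The diagonal matrix with entries `e ^ i` and `e ^ (-i)`, which generates a dense subgroup of the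
maximal torus. -/
noncomputable def SU2.torusGenerator : SU2 :=
  ⟨!![Complex.exp Complex.I, 0; 0, (Complex.exp Complex.I)⁻¹], by
    have h : (starRingEnd ℂ) (Complex.exp Complex.I) = (Complex.exp Complex.I)⁻¹ := by
      rw [← Complex.exp_conj, Complex.conj_I, Complex.exp_neg]
    rw [Matrix.mem_specialUnitaryGroup_iff, Matrix.mem_unitaryGroup_iff]
    constructor
    · ext i j
      fin_cases i <;> fin_cases j <;>
        simp [Matrix.mul_apply, Fin.sum_univ_two, Matrix.star_apply, h]
    · simp⟩

theorem entryMonomial_torusGenerator_mul (a b c d : ℕ) (g : SU2) :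
    entryMonomial a b c d (SU2.torusGenerator * g) =
      Complex.exp Complex.I ^ ((a + b : ℤ) - (c + d)) * entryMonomial a b c d g := by
  have hz := Complex.exp_ne_zero Complex.I
  have h0 : ∀ j, (SU2.torusGenerator * g).1 0 j = Complex.exp Complex.I * g.1 0 j := fun j => by
    simp [SU2.torusGenerator, Matrix.mul_apply, Fin.sum_univ_two]
  have h1 : ∀ j, (SU2.torusGenerator * g).1 1 j = (Complex.exp Complex.I)⁻¹ * g.1 1 j := fun j => by
    simp [SU2.torusGenerator, Matrix.mul_apply, Fin.sum_univ_two]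
  rw [entryMonomial, entryMonomial, h0, h0, h1, h1, zpow_sub₀ hz, zpow_add₀ hz, zpow_add₀ hz]
  simp only [zpow_natCast, mul_pow, inv_pow]
  field_simp

theorem entryMonomial_mul_torusGenerator (a b c d : ℕ) (g : SU2) :
    entryMonomial a b c d (g * SU2.torusGenerator) =
      Complex.exp Complex.I ^ ((a + c : ℤ) - (b + d)) * entryMonomial a b c d g := by
  have hz := Complex.exp_ne_zero Complex.I
  have h0 : ∀ j, (g * SU2.torusGenerator).1 j 0 = Complex.exp Complex.I * g.1 j 0 := fun j => by
    simp [SU2.torusGenerator, Matrix.mul_apply, Fin.sum_univ_two, mul_comm]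
  have h1 : ∀ j, (g * SU2.torusGenerator).1 j 1 = (Complex.exp Complex.I)⁻¹ * g.1 j 1 := fun j => by
    simp [SU2.torusGenerator, Matrix.mul_apply, Fin.sum_univ_two, mul_comm]
  rw [entryMonomial, entryMonomial, h0, h0, h1, h1, zpow_sub₀ hz, zpow_add₀ hz, zpow_add₀ hz]
  simp only [zpow_natCast, mul_pow, inv_pow]
  field_simp

/-- The integer `2m` for the label `(ℓ, m, n)`. -/
def SpinLabel.leftWeight (s : SpinLabel) : ℤ := 2 * (s.2.1 : ℕ) - s.1

/-- The integer `2n` for the label `(ℓ, m, n)`. -/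
def SpinLabel.rightWeight (s : SpinLabel) : ℤ := 2 * (s.2.2 : ℕ) - s.1

theorem SpinLabel.weight_eq (s : SpinLabel) :
    s.weight = ((s.leftWeight : ℝ) / 2, (s.rightWeight : ℝ) / 2) := by
  simp only [weight, leftWeight, rightWeight]
  push_cast
  ext <;> ring

/-- Every monomial with a nonzero coefficient has the same degree in each row of the matrix, hence
the same eigenvalue. -/
theorem matrixElement_torusGenerator_mul (s : SpinLabel) (g : SU2) :
    matrixElement s (SU2.torusGenerator * g) =
      Complex.exp Complex.I ^ (-s.leftWeight) * matrixElement s g := by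
  obtain ⟨r, -, h⟩ := exists_matrixElement_eq s
  rw [h, h, mul_left_comm]
  refine congrArg (r * ·) ?_
  rw [Finset.mul_sum]
  refine Finset.sum_congr rfl fun p hp => ?_
  rw [Finset.HasAntidiagonal.mem_antidiagonal] at hp
  rw [entryMonomial_torusGenerator_mul]
  -- Where the natural-number subtractions in the exponents truncate, a binomial coefficient is
  -- zero.
  by_cases hp1 : s.1 - s.2.2 < p.1
  · simp [Nat.choose_eq_zero_of_lt hp1]
  by_cases hp2 : (s.2.2 : ℕ) < p.2
  · simp [Nat.choose_eq_zero_of_lt hp2]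
  have hexp : ((p.1 : ℤ) + p.2) - (((s.1 - s.2.2 - p.1 : ℕ) : ℤ) + ((s.2.2 - p.2 : ℕ) : ℤ)) =
      -s.leftWeight := by
    have := s.2.1.isLt
    have := s.2.2.isLt
    rw [SpinLabel.leftWeight]
    omega
  rw [hexp]
  ring

theorem matrixElement_mul_torusGenerator (s : SpinLabel) (g : SU2) :
    matrixElement s (g * SU2.torusGenerator) =
      Complex.exp Complex.I ^ (-s.rightWeight) * matrixElement s g := by
  obtain ⟨r, -, h⟩ := exists_matrixElement_eq s
  rw [h, h, mul_left_comm]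
  refine congrArg (r * ·) ?_
  rw [Finset.mul_sum]
  refine Finset.sum_congr rfl fun p hp => ?_
  rw [Finset.HasAntidiagonal.mem_antidiagonal] at hp
  rw [entryMonomial_mul_torusGenerator]
  by_cases hp1 : s.1 - s.2.2 < p.1
  · simp [Nat.choose_eq_zero_of_lt hp1]
  by_cases hp2 : (s.2.2 : ℕ) < p.2
  · simp [Nat.choose_eq_zero_of_lt hp2]
  have hexp : ((p.1 : ℤ) + ((s.1 - s.2.2 - p.1 : ℕ) : ℤ)) - (p.2 + ((s.2.2 - p.2 : ℕ) : ℤ)) =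
      -s.rightWeight := by
    have := s.2.1.isLt
    have := s.2.2.isLt
    rw [SpinLabel.rightWeight]
    omega
  rw [hexp]
  ring

/-- Since `π` is irrational, no nonzero integer is a multiple of `2π`; one group element therefore
separates all weights. -/
theorem exp_I_zpow_injective : Function.Injective fun w : ℤ => Complex.exp Complex.I ^ w := by
  intro v w h
  simp only [← Complex.exp_int_mul] at h
  obtain ⟨n, hn⟩ := Complex.exp_eq_exp_iff_exists_int.1 h
  have hn' : (v : ℝ) = w + n * (2 * Real.pi) := by
    have := congrArg Complex.im hn
    simpa using this
  have hn0 : n = 0 := by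
    by_contra hn0
    have hn0' : (n : ℝ) ≠ 0 := by exact_mod_cast hn0
    refine irrational_pi ⟨(v - w) / (2 * n), ?_⟩
    push_cast
    rw [hn']
    field_simp
    ring
  subst hn0
  simpa using hn'

theorem exists_abs_le_of_exp_I_zpow_mem {E : Set ℂ} (hE : E.Finite) :
    ∃ B : ℝ, ∀ w : ℤ, Complex.exp Complex.I ^ (-w) ∈ E → |(w : ℝ)| ≤ B := by
  have hfin : {w : ℤ | Complex.exp Complex.I ^ (-w) ∈ E}.Finite :=
    hE.preimage (exp_I_zpow_injective.comp neg_injective).injOn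
  obtain ⟨B, hB⟩ := (hfin.image fun w : ℤ => |(w : ℝ)|).bddAbove
  exact ⟨B, fun w hw => hB ⟨w, hw, rfl⟩⟩

/-! ### Vanishing when the origin is outside the hull -/

theorem mathieuProperty_of_zero_notMem {k : ℕ} (A : Fin k → ℂ) (s : Fin k → SpinLabel)
    (hs : ((0, 0) : ℝ × ℝ) ∉ closedConvexHull ℝ (Set.range fun i => (s i).weight)) :
    MathieuProperty (matrixElementSum A s) := by
  intro _ h hh
  obtain ⟨Λ, c, hc0, hc⟩ := geometric_hahn_banach_point_closed convex_closedConvexHull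
    isClosed_closedConvexHull hs
  have hcpos : 0 < c := by simpa [← Prod.zero_eq_mk] using hc0
  obtain ⟨E₁, hE₁, h₁⟩ := hh.exists_finite_eigenvalues_mul_left SU2.torusGenerator
  obtain ⟨E₂, hE₂, h₂⟩ := hh.exists_finite_eigenvalues_mul_right SU2.torusGenerator
  obtain ⟨B₁, hB₁⟩ := exists_abs_le_of_exp_I_zpow_mem hE₁
  obtain ⟨B₂, hB₂⟩ := exists_abs_le_of_exp_I_zpow_mem hE₂
  -- The numerator bounds `Λ` on any weight sum that can pair with `h`; the halves appear because
  -- the integer weights are `2m` and `2n`.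
  obtain ⟨P₀, hP₀⟩ := exists_nat_gt ((B₁ / 2 * |Λ (1, 0)| + B₂ / 2 * |Λ (0, 1)|) / c)
  filter_upwards [eventually_ge_atTop P₀] with P hP
  have hpow : ∀ g, matrixElementSum A s g ^ P * h g = ∑ p : Fin P → Fin k,
      (∏ i, A (p i)) * ((∏ i, matrixElement (s (p i)) g) * h g) := by
    intro g
    rw [matrixElementSum, Fintype.sum_pow, Finset.sum_mul]
    simp_rw [Finset.prod_mul_distrib, mul_assoc]
  have hqcont : ∀ p : Fin P → Fin k, Continuous fun g => ∏ i, matrixElement (s (p i)) g :=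
    fun p => continuous_finsetProd _ fun i _ => continuous_matrixElement _
  simp_rw [hpow]
  unfold haarIntegral
  refine (integral_finsetSum Finset.univ fun p _ => Continuous.integrable_haarMeasure_top
    (f := fun g => (∏ i, A (p i)) * ((∏ i, matrixElement (s (p i)) g) * h g))
    (continuous_const.mul ((hqcont p).mul hh.1))).trans ?_
  refine Finset.sum_eq_zero fun p _ => ?_
  rw [integral_const_mul]
  refine mul_eq_zero_of_right _ ?_
  by_contra hne
  have hz : ∀ w : ℤ, Complex.exp Complex.I ^ w ≠ 0 := fun w => zpow_ne_zero _ (Complex.exp_ne_zero _)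
  have hprod : ∀ v : Fin P → ℤ, ∏ i, Complex.exp Complex.I ^ (-v i) =
      Complex.exp Complex.I ^ (-∑ i, v i) := fun v => by
    rw [← Finset.sum_neg_distrib]
    simp only [← Complex.exp_int_mul, ← Complex.exp_sum, Int.cast_sum, Finset.sum_mul]
  have hw₁ := hB₁ (∑ i, (s (p i)).leftWeight) <| h₁ _ _ (hqcont p) (hz _) (fun g => by
    simp_rw [matrixElement_torusGenerator_mul, Finset.prod_mul_distrib, hprod]) hne
  have hw₂ := hB₂ (∑ i, (s (p i)).rightWeight) <| h₂ _ _ (hqcont p) (hz _) (fun g => by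
    simp_rw [matrixElement_mul_torusGenerator, Finset.prod_mul_distrib, hprod]) hne
  have hΛ : ∀ x y : ℝ, Λ (x, y) = x * Λ (1, 0) + y * Λ (0, 1) := fun x y => by
    have hxy : ((x, y) : ℝ × ℝ) = x • (1, 0) + y • (0, 1) := by ext <;> simp
    rw [hxy, map_add, map_smul, map_smul, smul_eq_mul, smul_eq_mul]
  have hlow : P * c ≤ ∑ i, Λ (s (p i)).weight := by
    have := Finset.card_nsmul_le_sum Finset.univ (fun i => Λ (s (p i)).weight) c
      fun i _ => (hc _ (subset_closedConvexHull ⟨p i, rfl⟩)).le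
    simpa using this
  have hsum : ∑ i, Λ (s (p i)).weight = ((∑ i, (s (p i)).leftWeight : ℤ) : ℝ) / 2 * Λ (1, 0) +
      ((∑ i, (s (p i)).rightWeight : ℤ) : ℝ) / 2 * Λ (0, 1) := by
    have hterm : ∀ i, Λ (s (p i)).weight = ((s (p i)).leftWeight : ℝ) / 2 * Λ (1, 0) +
        ((s (p i)).rightWeight : ℝ) / 2 * Λ (0, 1) := fun i => by rw [SpinLabel.weight_eq, hΛ]
    simp_rw [hterm]
    push_cast
    rw [Finset.sum_add_distrib, ← Finset.sum_mul, ← Finset.sum_mul, ← Finset.sum_div,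
      ← Finset.sum_div]
  have hup : ∀ (w B l : ℝ), |w| ≤ B → w / 2 * l ≤ B / 2 * |l| := fun w B l hwB =>
    calc w / 2 * l ≤ |w / 2 * l| := le_abs_self _
      _ = |w| / 2 * |l| := by rw [abs_mul, abs_div, abs_two]
      _ ≤ B / 2 * |l| := by gcongr
  rw [div_lt_iff₀ hcpos] at hP₀
  have hPc : (P₀ : ℝ) * c ≤ P * c := by gcongr
  have := hup _ _ (Λ (1, 0)) hw₁
  have := hup _ _ (Λ (0, 1)) hw₂
  linarith

/-! ### The span of the matrix elements as a dense algebra -/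

/-- The span of all matrix elements. -/
def matrixElementSpan : Submodule ℂ (SU2 → ℂ) :=
  Submodule.span ℂ (Set.range matrixElement)

theorem entryMonomial_succ_succ (a b c d : ℕ) :
    entryMonomial (a + 1) b c (d + 1) - entryMonomial a (b + 1) (c + 1) d =
      entryMonomial a b c d := by
  ext g
  have hdet : g.1 0 0 * g.1 1 1 - g.1 0 1 * g.1 1 0 = 1 := by
    rw [← Matrix.det_fin_two]
    exact (Matrix.mem_specialUnitaryGroup_iff.1 g.2).2
  calc _ = (g.1 0 0 * g.1 1 1 - g.1 0 1 * g.1 1 0) * entryMonomial a b c d g := by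
        simp only [Pi.sub_apply, entryMonomial]
        ring
    _ = _ := by rw [hdet, one_mul]

/-- By induction on the degree: since `αδ - βγ = 1`, monomials of degree `N` with equal row and
column degrees agree modulo lower degree. A matrix element of spin `N / 2` is a combination of
monomials in one such class, so it is a multiple of any one of them modulo the span. -/
theorem entryMonomial_mem_matrixElementSpan (N : ℕ) :
    ∀ a b c d, a + b + c + d = N → entryMonomial a b c d ∈ matrixElementSpan := by
  induction N using Nat.strong_induction_on with
  | _ N ih =>
  have hshift : ∀ n a b c d, a + b + c + d + 2 * n = N →
      entryMonomial (a + n) b c (d + n) - entryMonomial a (b + n) (c + n) d ∈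
        matrixElementSpan := by
    intro n
    induction n with
    | zero => simp
    | succ n ihn =>
      intro a b c d hN
      have h1 := ihn (a + 1) b c (d + 1) (by omega)
      have h2 : entryMonomial (a + 1) (b + n) (c + n) (d + 1) -
          entryMonomial a (b + n + 1) (c + n + 1) d ∈ matrixElementSpan := by
        rw [entryMonomial_succ_succ]
        exact ih _ (by omega) _ _ _ _ rfl
      have := Submodule.add_mem _ h1 h2
      rw [sub_add_sub_cancel] at this
      convert this using 3 <;> omega
  have hclass : ∀ a b c d a' b' c' d', a + b + c + d = N → a' + b' + c' + d' = N →
      a + b = a' + b' → a + c = a' + c' →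
      entryMonomial a b c d - entryMonomial a' b' c' d' ∈ matrixElementSpan := by
    intro a b c d a' b' c' d' h h' hab hac
    rcases le_total a a' with hle | hle
    · obtain ⟨n, rfl⟩ := Nat.exists_eq_add_of_le hle
      obtain rfl : b = b' + n := by omega
      obtain rfl : c = c' + n := by omega
      obtain rfl : d' = d + n := by omega
      rw [← Submodule.neg_mem_iff, neg_sub]
      exact hshift n _ _ _ _ (by omega)
    · obtain ⟨n, rfl⟩ := Nat.exists_eq_add_of_le hle
      obtain rfl : b' = b + n := by omega
      obtain rfl : c' = c + n := by omega
      obtain rfl : d = d' + n := by omega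
      exact hshift n _ _ _ _ (by omega)
  intro a b c d hN
  -- The label whose matrix element involves exactly the row and column degrees of the given
  -- monomial.
  let s : SpinLabel := ⟨N, ⟨c + d, by omega⟩, ⟨b + d, by omega⟩⟩
  obtain ⟨r, hr, h⟩ := exists_matrixElement_eq s
  have hi : N - (c + d) = a + b := by omega
  have hj : N - (b + d) = a + c := by omega
  simp only [s, hi, hj] at h
  let coef : ℕ × ℕ → ℂ := fun p => (a + c).choose p.1 * (b + d).choose p.2
  have hsum : ∑ p ∈ Finset.HasAntidiagonal.antidiagonal (a + b),
      coef p • entryMonomial p.1 p.2 (a + c - p.1) (b + d - p.2) ∈ matrixElementSpan := by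
    have hmem : r⁻¹ • matrixElement s ∈ matrixElementSpan :=
      Submodule.smul_mem _ _ (Submodule.subset_span ⟨s, rfl⟩)
    convert hmem using 1
    ext g
    rw [Pi.smul_apply, h, smul_eq_mul, inv_mul_cancel_left₀ hr]
    simp [coef]
  have hdiff : ∑ p ∈ Finset.HasAntidiagonal.antidiagonal (a + b),
      coef p • (entryMonomial a b c d - entryMonomial p.1 p.2 (a + c - p.1) (b + d - p.2)) ∈
        matrixElementSpan := by
    refine Submodule.sum_mem _ fun p hp => ?_
    rw [Finset.HasAntidiagonal.mem_antidiagonal] at hp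
    by_cases hp1 : a + c < p.1
    · simp [coef, Nat.choose_eq_zero_of_lt hp1]
    by_cases hp2 : b + d < p.2
    · simp [coef, Nat.choose_eq_zero_of_lt hp2]
    exact Submodule.smul_mem _ _
      (hclass _ _ _ _ _ _ _ _ hN (by omega) (by omega) (by omega))
  have htotal := Submodule.add_mem _ hdiff hsum
  rw [← Finset.sum_add_distrib] at htotal
  simp_rw [← smul_add, sub_add_cancel] at htotal
  rw [← Finset.sum_smul] at htotal
  -- Vandermonde's identity shows that the coefficients do not cancel.
  have hcoef : ∑ p ∈ Finset.HasAntidiagonal.antidiagonal (a + b), coef p =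
      ((a + c + (b + d)).choose (a + b) : ℕ) := by
    rw [Nat.add_choose_eq]
    push_cast
    rfl
  rw [hcoef] at htotal
  refine (Submodule.smul_mem_iff _ ?_).1 htotal
  exact_mod_cast (Nat.choose_pos (by omega)).ne'

theorem matrixElementSpan_eq : matrixElementSpan = Submodule.span ℂ
    (Set.range fun q : (ℕ × ℕ) × ℕ × ℕ => entryMonomial q.1.1 q.1.2 q.2.1 q.2.2) := by
  apply le_antisymm
  · refine Submodule.span_le.2 ?_
    rintro _ ⟨s, rfl⟩
    obtain ⟨r, -, h⟩ := exists_matrixElement_eq s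
    have : matrixElement s = r • ∑ p ∈ Finset.HasAntidiagonal.antidiagonal (s.1 - (s.2.1 : ℕ)),
        ((s.1 - (s.2.2 : ℕ)).choose p.1 * (s.2.2 : ℕ).choose p.2 : ℂ) •
          entryMonomial p.1 p.2 (s.1 - (s.2.2 : ℕ) - p.1) ((s.2.2 : ℕ) - p.2) := by
      ext g
      rw [h]
      simp
    rw [this]
    exact Submodule.smul_mem _ _ (Submodule.sum_mem _ fun p _ => Submodule.smul_mem _ _
      (Submodule.subset_span ⟨((_, _), _, _), rfl⟩))
  · refine Submodule.span_le.2 ?_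
    rintro _ ⟨q, rfl⟩
    exact entryMonomial_mem_matrixElementSpan _ _ _ _ _ rfl

theorem one_mem_matrixElementSpan : (1 : SU2 → ℂ) ∈ matrixElementSpan := by
  convert entryMonomial_mem_matrixElementSpan _ 0 0 0 0 rfl using 1
  ext g
  simp [entryMonomial]

theorem entry_mem_matrixElementSpan (i j : Fin 2) :
    (fun g : SU2 => g.1 i j) ∈ matrixElementSpan := by
  fin_cases i <;> fin_cases j
  · convert entryMonomial_mem_matrixElementSpan _ 1 0 0 0 rfl using 1
    ext g
    simp [entryMonomial]
  · convert entryMonomial_mem_matrixElementSpan _ 0 1 0 0 rfl using 1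
    ext g
    simp [entryMonomial]
  · convert entryMonomial_mem_matrixElementSpan _ 0 0 1 0 rfl using 1
    ext g
    simp [entryMonomial]
  · convert entryMonomial_mem_matrixElementSpan _ 0 0 0 1 rfl using 1
    ext g
    simp [entryMonomial]

theorem mul_mem_matrixElementSpan {f h : SU2 → ℂ} (hf : f ∈ matrixElementSpan)
    (hh : h ∈ matrixElementSpan) : f * h ∈ matrixElementSpan := by
  rw [matrixElementSpan_eq] at hf hh
  induction hf, hh using Submodule.span_induction₂ with
  | mem_mem x y hx hy =>
    obtain ⟨p, rfl⟩ := hx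
    obtain ⟨q, rfl⟩ := hy
    convert entryMonomial_mem_matrixElementSpan _ (p.1.1 + q.1.1) (p.1.2 + q.1.2)
      (p.2.1 + q.2.1) (p.2.2 + q.2.2) rfl using 1
    ext g
    simp only [Pi.mul_apply, entryMonomial]
    ring
  | zero_left y hy => simp
  | zero_right x hx => simp
  | add_left x y z _ _ _ h₁ h₂ => rw [add_mul]; exact Submodule.add_mem _ h₁ h₂
  | add_right x y z _ _ _ h₁ h₂ => rw [mul_add]; exact Submodule.add_mem _ h₁ h₂
  | smul_left r x y _ _ h => rw [smul_mul_assoc]; exact Submodule.smul_mem _ _ h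
  | smul_right r x y _ _ h => rw [mul_smul_comm]; exact Submodule.smul_mem _ _ h

/-- The conjugate transpose and the adjugate are both inverses of `g`, so conjugation keeps
polynomials in the entries polynomial. -/
theorem SU2.star_entry (g : SU2) (i j : Fin 2) : star (g.1 i j) = g.1.adjugate j i := by
  have hdet : g.1.det = 1 := (Matrix.mem_specialUnitaryGroup_iff.1 g.2).2
  have hstar : star g.1 * g.1 = 1 :=
    Matrix.mem_unitaryGroup_iff'.1 (Matrix.mem_specialUnitaryGroup_iff.1 g.2).1
  have hadj : g.1 * g.1.adjugate = 1 := by rw [Matrix.mul_adjugate, hdet, one_smul]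
  rw [← left_inv_eq_right_inv hstar hadj, Matrix.star_apply]

theorem star_mem_matrixElementSpan {f : SU2 → ℂ} (hf : f ∈ matrixElementSpan) :
    star f ∈ matrixElementSpan := by
  rw [matrixElementSpan_eq] at hf
  induction hf using Submodule.span_induction with
  | mem x hx =>
    obtain ⟨p, rfl⟩ := hx
    have h := Submodule.smul_mem _ ((-1 : ℂ) ^ (p.1.2 + p.2.1))
      (entryMonomial_mem_matrixElementSpan _ p.2.2 p.2.1 p.1.2 p.1.1 rfl)
    convert h using 1
    ext g
    simp only [Pi.star_apply, entryMonomial, star_mul', star_pow, SU2.star_entry,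
      Matrix.adjugate_fin_two, Pi.smul_apply, smul_eq_mul]
    simp only [Matrix.of_apply, Matrix.cons_val', Matrix.cons_val_zero, Matrix.cons_val_one,
      Matrix.cons_val_fin_one]
    rw [neg_pow (g.1 1 0), neg_pow (g.1 0 1)]
    ring
  | zero => simp
  | add x y _ _ h₁ h₂ => rw [star_add]; exact Submodule.add_mem _ h₁ h₂
  | smul r x _ h => rw [star_smul]; exact Submodule.smul_mem _ _ h

/-- The star algebra of continuous functions spanned by the matrix elements. -/
def matrixElementStarSubalgebra : StarSubalgebra ℂ C(SU2, ℂ) where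
  carrier := {k | (k : SU2 → ℂ) ∈ matrixElementSpan}
  mul_mem' hf hh := mul_mem_matrixElementSpan hf hh
  one_mem' := one_mem_matrixElementSpan
  add_mem' hf hh := Submodule.add_mem matrixElementSpan hf hh
  zero_mem' := Submodule.zero_mem matrixElementSpan
  algebraMap_mem' r := by
    have h := Submodule.smul_mem _ r one_mem_matrixElementSpan
    have hr : r • (1 : SU2 → ℂ) = (algebraMap ℂ C(SU2, ℂ) r : C(SU2, ℂ)) := by
      ext g
      simp
    rwa [hr] at h
  star_mem' hf := star_mem_matrixElementSpan hf

theorem dense_matrixElementSpan : Dense {k : C(SU2, ℂ) | (k : SU2 → ℂ) ∈ matrixElementSpan} := by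
  have h := ContinuousMap.starSubalgebra_topologicalClosure_eq_top_of_separatesPoints
    matrixElementStarSubalgebra fun x y hxy => by
      obtain ⟨i, j, hij⟩ : ∃ i j, x.1 i j ≠ y.1 i j := by
        by_contra! h
        exact hxy (Subtype.ext (Matrix.ext h))
      exact ⟨_, ⟨⟨fun g => g.1 i j, SU2.continuous_entry i j⟩,
        show _ ∈ matrixElementSpan from entry_mem_matrixElementSpan i j, rfl⟩, hij⟩
  have hcoe := congrArg (fun A : StarSubalgebra ℂ C(SU2, ℂ) => (A : Set C(SU2, ℂ))) h
  rw [dense_iff_closure_eq]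
  exact hcoe

/-! ### Convolution stability and finite functions -/

/-- `k (x * y)` is a finite sum of products `a x * b y` with `a` in the span of the matrix elements
and `b` continuous. -/
def HasComultiplication (k : SU2 → ℂ) : Prop :=
  ∃ (ι : Type) (_ : Fintype ι) (a b : ι → SU2 → ℂ), (∀ i, a i ∈ matrixElementSpan) ∧
    (∀ i, Continuous (b i)) ∧ ∀ x y, k (x * y) = ∑ i, a i x * b i y

theorem HasComultiplication.add {k l : SU2 → ℂ} (hk : HasComultiplication k)
    (hl : HasComultiplication l) : HasComultiplication (k + l) := by
  obtain ⟨ι, _, a, b, ha, hb, h⟩ := hk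
  obtain ⟨κ, _, a', b', ha', hb', h'⟩ := hl
  exact ⟨ι ⊕ κ, inferInstance, Sum.elim a a', Sum.elim b b', by simp [ha, ha'], by simp [hb, hb'],
    fun x y => by simp [h, h']⟩

theorem HasComultiplication.mul {k l : SU2 → ℂ} (hk : HasComultiplication k)
    (hl : HasComultiplication l) : HasComultiplication (k * l) := by
  obtain ⟨ι, _, a, b, ha, hb, h⟩ := hk
  obtain ⟨κ, _, a', b', ha', hb', h'⟩ := hl
  refine ⟨ι × κ, inferInstance, fun p => a p.1 * a' p.2, fun p => b p.1 * b' p.2,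
    fun p => mul_mem_matrixElementSpan (ha _) (ha' _), fun p => (hb _).mul (hb' _), fun x y => ?_⟩
  rw [Pi.mul_apply, h, h', Finset.sum_mul_sum, Fintype.sum_prod_type]
  refine Finset.sum_congr rfl fun i _ => Finset.sum_congr rfl fun j _ => ?_
  simp only [Pi.mul_apply]
  ring

theorem hasComultiplication_const (r : ℂ) : HasComultiplication fun _ => r :=
  ⟨Unit, inferInstance, fun _ => 1, fun _ _ => r, fun _ => one_mem_matrixElementSpan,
    fun _ => continuous_const, fun x y => by simp⟩

theorem HasComultiplication.pow {k : SU2 → ℂ} (hk : HasComultiplication k) (n : ℕ) :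
    HasComultiplication (k ^ n) := by
  induction n with
  | zero => rw [pow_zero]; exact hasComultiplication_const 1
  | succ n ih => rw [pow_succ]; exact ih.mul hk

theorem hasComultiplication_entry (i j : Fin 2) : HasComultiplication fun g => g.1 i j :=
  ⟨Fin 2, inferInstance, fun l g => g.1 i l, fun l g => g.1 l j,
    fun l => entry_mem_matrixElementSpan i l, fun l => SU2.continuous_entry l j,
    fun _ _ => Matrix.mul_apply⟩

/-- Matrix multiplication gives the property for entries, and it passes to products and sums.
Integrating out `y` then leaves a convolution in the span of the `a i`. -/
theorem hasComultiplication_of_mem {k : SU2 → ℂ} (hk : k ∈ matrixElementSpan) :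
    HasComultiplication k := by
  rw [matrixElementSpan_eq] at hk
  induction hk using Submodule.span_induction with
  | mem x hx =>
    obtain ⟨p, rfl⟩ := hx
    exact ((((hasComultiplication_entry 0 0).pow _).mul ((hasComultiplication_entry 0 1).pow _)).mul
      ((hasComultiplication_entry 1 0).pow _)).mul ((hasComultiplication_entry 1 1).pow _)
  | zero => exact hasComultiplication_const 0
  | add x y _ _ h₁ h₂ => exact h₁.add h₂
  | smul r x _ h => exact (hasComultiplication_const r).mul h

/-- Every `SU(2)`-finite function is a linear combination of matrix elements. -/
theorem IsGFinite.mem_matrixElementSpan {f : SU2 → ℂ} (hf : IsGFinite f) :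
    f ∈ matrixElementSpan := by
  refine hf.mem_of_dense _ dense_matrixElementSpan fun k hk w _ hw => ?_
  obtain ⟨ι, _, a, b, ha, hb, h⟩ := hasComultiplication_of_mem hk
  have : (fun x => haarIntegral SU2 fun y => k (x * y) * w y) =
      ∑ i, (haarIntegral SU2 fun y => b i y * w y) • a i := by
    ext x
    simp_rw [h, Finset.sum_mul]
    unfold haarIntegral
    rw [Finset.sum_apply]
    refine (integral_finsetSum Finset.univ fun i _ => Continuous.integrable_haarMeasure_top
      (f := fun y => a i x * b i y * w y)
      ((continuous_const.mul (hb i)).mul hw)).trans ?_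
    refine Finset.sum_congr rfl fun i _ => ?_
    simp_rw [mul_assoc]
    rw [integral_const_mul, Pi.smul_apply, smul_eq_mul, mul_comm]
  rw [this]
  exact Submodule.sum_mem _ fun i _ => Submodule.smul_mem _ _ (ha i)

theorem exists_matrixElementSum_eq {f : SU2 → ℂ} (hf : f ∈ matrixElementSpan) :
    ∃ (k : ℕ) (A : Fin k → ℂ) (s : Fin k → SpinLabel),
      (∀ i, A i ≠ 0) ∧ Function.Injective s ∧ f = matrixElementSum A s := by
  obtain ⟨c, rfl⟩ := Finsupp.mem_span_range_iff_exists_finsupp.1 hf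
  let e := c.support.equivFin.symm
  refine ⟨_, fun i => c (e i), fun i => e i, fun i => Finsupp.mem_support_iff.1 (e i).2,
    Subtype.val_injective.comp e.injective, ?_⟩
  ext g
  rw [matrixElementSum, Equiv.sum_comp e fun x => c x * matrixElement x g, Finsupp.sum,
    Finset.sum_apply, ← Finset.sum_coe_sort]
  rfl

theorem mainTheorem1 :
    (∀ (k : ℕ) (A : Fin k → ℂ) (s : Fin k → SpinLabel),
      (∀ i, A i ≠ 0) → Function.Injective s →
        ConvexHullCriterion A s → MathieuProperty (matrixElementSum A s)) ∧
    (ConvexHullConjecture → MathieuConjectureFor SU2) := by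
  have key : ∀ (k : ℕ) (A : Fin k → ℂ) (s : Fin k → SpinLabel),
      ConvexHullCriterion A s → MathieuProperty (matrixElementSum A s) :=
    fun k A s h hint => mathieuProperty_of_zero_notMem A s (h.1 hint) hint
  refine ⟨fun k A s _ _ => key k A s, fun hconj f hf => ?_⟩
  obtain ⟨k, A, s, hA, hs, rfl⟩ := exists_matrixElementSum_eq hf.mem_matrixElementSpan
  exact key k A s (hconj k A s hA hs)
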